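/- Let $G$ and $H$ be groups, each of which is polycyclic (there is a finite series of subgroups $1=G_0\le G_1\le\dots\le G_l=G$ with each $G_i$ normal in $G_{i+1}$ and each $G_{i+1}/G_i$ cyclic), residually nilpotent ($\bigcap_{i\ge 1}\gamma_i(G)=1$, where $\gamma_1(G)=G$ and $\gamma_{i+1}(G)=[\gamma_i(G),G]$), and metabelian (the derived subgroup $G'=[G,G]$ is abelian). Let $\phi:G\to H$ be a group homomorphism such that the induced homomorphism $G_{ab}=G/G'\to H/H'=H_{ab}$ is an isomorphism. Then $h(H)\le h(G)$, where the Hirsch length $h$ of a polycyclic group is the number of infinite factors in a series as above (this number does not depend on the series). -/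

import Mathlib

/-- A polycyclic series of a group `G` (in the usual sense of subnormal series with cyclic factors):
`1 = G₀ ≤ G₁ ≤ ⋯ ≤ G_l = G`, where each `G_i` is normal in `G_{i+1}` and each factor
`G_{i+1}/G_i` is cyclic. Only the values `term i` with `i ≤ length` matter. -/
structure PolycyclicSeries (G : Type*) [Group G] where
  length : ℕ
  term : ℕ → Subgroup G
  term_zero : term 0 = ⊥
  term_length : term length = ⊤
  le_succ : ∀ i < length, term i ≤ term (i + 1)
  normal : ∀ i < length, ((term i).subgroupOf (term (i + 1))).Normal
  cyclic : ∀ (i : ℕ) (hi : i < length),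
    haveI := normal i hi
    IsCyclic (term (i + 1) ⧸ (term i).subgroupOf (term (i + 1)))

open scoped Classical in
/-- The number of infinite (that is, infinite cyclic) factors of a polycyclic series. -/
noncomputable def PolycyclicSeries.infiniteFactors {G : Type*} [Group G]
    (s : PolycyclicSeries G) : ℕ :=
  {i ∈ Finset.range s.length |
    Infinite (s.term (i + 1) ⧸ (s.term i).subgroupOf (s.term (i + 1)))}.card

/-- A group is polycyclic if it has a polycyclic series. -/
def IsPolycyclic (G : Type*) [Group G] : Prop := Nonempty (PolycyclicSeries G)

open scoped Classical in
/-- The Hirsch length of a polycyclic group: the number of infinite factors in a polycyclic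
series. It does not depend on the series, see `PolycyclicSeries.infiniteFactors_eq_hirschLength`.
(The value is `0` if `G` is not polycyclic.) -/
noncomputable def hirschLength (G : Type*) [Group G] : ℕ :=
  if h : IsPolycyclic G then (Classical.choice h).infiniteFactors else 0

/-- `G` is residually nilpotent: the terms of its lower central series intersect trivially. -/
def IsResiduallyNilpotent (G : Type*) [Group G] : Prop :=
  ⨅ n : ℕ, (⊤ : Subgroup G).lowerCentralSeries n = ⊥

/-- `G` is metabelian: its second derived subgroup is trivial, that is, its derived subgroup is
abelian. -/
def IsMetabelian (G : Type*) [Group G] : Prop := derivedSeries G 2 = ⊥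

/-- In a cyclic group, every nontrivial subgroup has finite index. -/
theorem index_ne_zero_of_isCyclic {Q : Type*} [Group Q] [IsCyclic Q] {K : Subgroup Q} {y : Q}
    (hyK : y ∈ K) (hy : y ≠ 1) : K.index ≠ 0 := by
  obtain ⟨g, hg⟩ := IsCyclic.exists_generator (α := Q)
  let _ : CommGroup Q := IsCyclic.commGroup
  obtain ⟨n, rfl⟩ := Subgroup.mem_zpowers_iff.1 (hg y)
  have hn : n ≠ 0 := by rintro rfl; simp at hy
  have hfin : IsOfFinOrder (g : Q ⧸ K) := by
    rw [isOfFinOrder_iff_zpow_eq_one]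
    refine ⟨n, hn, ?_⟩
    rw [← QuotientGroup.mk_zpow]
    exact (QuotientGroup.eq_one_iff _).2 hyK
  have htop : ((Subgroup.zpowers (g : Q ⧸ K) : Subgroup (Q ⧸ K)) : Set (Q ⧸ K)) = Set.univ := by
    rw [Set.eq_univ_iff_forall]
    intro x
    obtain ⟨x, rfl⟩ := QuotientGroup.mk_surjective x
    obtain ⟨m, rfl⟩ := Subgroup.mem_zpowers_iff.1 (hg x)
    exact Subgroup.mem_zpowers_iff.2 ⟨m, (QuotientGroup.mk_zpow K g m).symm⟩
  have : Finite (Q ⧸ K) := by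
    rw [← Set.finite_univ_iff, ← htop]
    exact finite_zpowers.2 hfin
  exact (Subgroup.finiteIndex_of_finite_quotient (H := K)).index_ne_zero

/-- If `f : L → Q` is a homomorphism such that `f(K)` has finite index in `Q` and `K ∩ ker f` has
finite index in `ker f`, then `K` has finite index in `L`. -/
theorem index_ne_zero_of_map {L Q : Type*} [Group L] [Group Q] (f : L →* Q) (K : Subgroup L)
    (h1 : (K.map f).index ≠ 0) (h2 : K.relIndex f.ker ≠ 0) : K.index ≠ 0 := by
  have h3 : (K ⊔ f.ker).index ≠ 0 := by
    rw [← Subgroup.comap_map_eq, Subgroup.index_comap]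
    exact fun h => h1 (Subgroup.index_eq_zero_of_relIndex_eq_zero h)
  have h4 : K.relIndex (K ⊔ f.ker) ≠ 0 := by
    have hfi : (K.subgroupOf f.ker).FiniteIndex := ⟨h2⟩
    have hfin : Finite (f.ker ⧸ K.subgroupOf f.ker) :=
      Subgroup.finite_quotient_of_finiteIndex
    have hle : f.ker ≤ K ⊔ f.ker := le_sup_right
    let F : (f.ker ⧸ K.subgroupOf f.ker) →
        ((K ⊔ f.ker : Subgroup L) ⧸ K.subgroupOf (K ⊔ f.ker)) :=
      Quotient.map' (Subgroup.inclusion hle) (by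
        intro a b hab
        rw [QuotientGroup.leftRel_apply] at hab ⊢
        simpa [Subgroup.mem_subgroupOf] using hab)
    have hF : Function.Surjective F := by
      intro x
      obtain ⟨⟨x, hx⟩, rfl⟩ := QuotientGroup.mk_surjective x
      have hx' := hx
      rw [sup_comm, Subgroup.mem_sup_of_normal_left] at hx'
      obtain ⟨n, hn, k, hk, rfl⟩ := hx'
      refine ⟨QuotientGroup.mk ⟨n, hn⟩, ?_⟩
      refine QuotientGroup.eq.2 ?_
      simpa [Subgroup.mem_subgroupOf] using hk
    have := Finite.of_surjective F hF
    exact (Subgroup.finiteIndex_of_finite_quotient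
      (H := K.subgroupOf (K ⊔ f.ker))).index_ne_zero
  rw [← Subgroup.relIndex_mul_index (le_sup_left : K ≤ K ⊔ f.ker)]
  exact mul_ne_zero h4 h3

/-- The only way in which an infinite index can disappear on intersecting with the kernel of a
map to a cyclic group. -/
theorem relIndex_step {G : Type*} [Group G] {B C K L : Subgroup G}
    (hn : (B.subgroupOf C).Normal) (hc : IsCyclic (C ⧸ B.subgroupOf C))
    (hKL : K ≤ L) (hLC : L ≤ C) (h0 : K.relIndex L = 0)
    (h1 : (K ⊓ B).relIndex (L ⊓ B) ≠ 0) :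
    Infinite (C ⧸ B.subgroupOf C) ∧ K ≤ B ∧ ¬ L ≤ B := by
  let f : L →* C ⧸ B.subgroupOf C :=
    (QuotientGroup.mk' (B.subgroupOf C)).comp (Subgroup.inclusion hLC)
  have hmem : ∀ x : L, f x = 1 ↔ (x : G) ∈ B := fun x =>
    (QuotientGroup.eq_one_iff (N := B.subgroupOf C) (Subgroup.inclusion hLC x))
  have hker : f.ker = B.subgroupOf L := by
    ext x
    rw [MonoidHom.mem_ker, hmem, Subgroup.mem_subgroupOf]
  have h2 : (K.subgroupOf L).relIndex f.ker ≠ 0 := by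
    intro h
    apply h1
    rw [hker, ← Subgroup.inf_relIndex_right, ← Subgroup.relIndex_map_map_of_injective _ _
      L.subtype_injective, Subgroup.map_inf_eq _ _ _ L.subtype_injective,
      Subgroup.subgroupOf_map_subtype, Subgroup.subgroupOf_map_subtype] at h
    rw [inf_eq_left.2 hKL, inf_comm B L] at h
    rw [← h, ← inf_assoc, inf_eq_left.2 hKL]
  have h3 : ((K.subgroupOf L).map f).index = 0 := by
    by_contra h
    exact index_ne_zero_of_map f _ h h2 h0
  refine ⟨?_, ?_, ?_⟩
  · by_contra h
    rw [not_infinite_iff_finite] at h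
    exact (Subgroup.finiteIndex_of_finite_quotient
      (H := (K.subgroupOf L).map f)).index_ne_zero h3
  · intro x hx
    by_contra hxB
    refine index_ne_zero_of_isCyclic (K := (K.subgroupOf L).map f) (y := f ⟨x, hKL hx⟩)
      (Subgroup.mem_map_of_mem f (Subgroup.mem_subgroupOf.2 hx)) ?_ h3
    rw [Ne, hmem]
    exact hxB
  · intro h
    apply h1
    rw [inf_eq_left.2 h, inf_eq_left.2 (hKL.trans h)]
    exact h0

open scoped Classical in
/-- In a group with a polycyclic series, an ascending chain of subgroups inside the `j`-th term has
at most as many steps of infinite index as the series has up to its `j`-th term. -/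
theorem PolycyclicSeries.card_chain_le {G : Type*} [Group G] (s : PolycyclicSeries G) (l : ℕ)
    (j : ℕ) (hj : j ≤ s.length) (K : ℕ → Subgroup G) (hK : ∀ i < l, K i ≤ K (i + 1))
    (hKj : ∀ i ≤ l, K i ≤ s.term j) :
    {i ∈ Finset.range l | (K i).relIndex (K (i + 1)) = 0}.card ≤
      {i ∈ Finset.range j |
        Infinite (s.term (i + 1) ⧸ (s.term i).subgroupOf (s.term (i + 1)))}.card := by
  induction j generalizing K with
  | zero =>
    have : {i ∈ Finset.range l | (K i).relIndex (K (i + 1)) = 0} = ∅ := by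
      refine Finset.filter_eq_empty_iff.2 fun i hi => ?_
      have h1 := hKj (i + 1) (Finset.mem_range.1 hi)
      rw [s.term_zero, le_bot_iff] at h1
      simp [h1]
    simp [this]
  | succ j ih =>
    have hj' : j < s.length := hj
    have hmono : ∀ a b, a ≤ b → b ≤ l → K a ≤ K b := by
      intro a b hab
      induction b, hab using Nat.le_induction with
      | base => exact fun _ => le_rfl
      | succ b _ ihb => exact fun hb => (ihb (by omega)).trans (hK b (by omega))
    have ih' := ih hj'.le (fun i => K i ⊓ s.term j)
      (fun i hi => inf_le_inf_right _ (hK i hi)) (fun i _ => inf_le_right)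
    set S := {i ∈ Finset.range l | (K i).relIndex (K (i + 1)) = 0} with hS
    set T := {i ∈ Finset.range l |
      (K i ⊓ s.term j).relIndex (K (i + 1) ⊓ s.term j) = 0} with hT
    have key : ∀ i ∈ S \ T,
        Infinite (s.term (j + 1) ⧸ (s.term j).subgroupOf (s.term (j + 1))) ∧
          K i ≤ s.term j ∧ ¬ K (i + 1) ≤ s.term j := by
      intro i hi
      simp only [hS, hT, Finset.mem_sdiff, Finset.mem_filter, Finset.mem_range, not_and] at hi
      obtain ⟨⟨hil, hi0⟩, hi1⟩ := hi
      exact relIndex_step (s.normal j hj') (s.cyclic j hj') (hK i hil)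
        (hKj (i + 1) hil) hi0 (hi1 hil)
    have hcard : (S \ T).card ≤
        if Infinite (s.term (j + 1) ⧸ (s.term j).subgroupOf (s.term (j + 1))) then 1 else 0 := by
      split_ifs with hinf
      · refine Finset.card_le_one.2 fun a ha b hb => ?_
        have hla : a < l := by
          simp only [hS, Finset.mem_sdiff, Finset.mem_filter, Finset.mem_range] at ha
          exact ha.1.1
        have hlb : b < l := by
          simp only [hS, Finset.mem_sdiff, Finset.mem_filter, Finset.mem_range] at hb
          exact hb.1.1
        rcases lt_trichotomy a b with h | h | h
        · exact absurd ((hmono (a + 1) b h hlb.le).trans (key b hb).2.1) (key a ha).2.2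
        · exact h
        · exact absurd ((hmono (b + 1) a h hla.le).trans (key a ha).2.1) (key b hb).2.2
      · rw [Nat.le_zero, Finset.card_eq_zero, Finset.eq_empty_iff_forall_notMem]
        exact fun i hi => hinf (key i hi).1
    have h1 : S.card ≤ (S \ T).card + T.card := by
      rw [← Finset.card_union_of_disjoint Finset.sdiff_disjoint]
      exact Finset.card_le_card fun i hi => by
        by_cases h : i ∈ T <;> simp [h, hi]
    rw [Finset.range_add_one, Finset.filter_insert]
    split_ifs at hcard ⊢ with hinf
    · rw [Finset.card_insert_of_notMem (by simp)]
      omega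
    · omega

/-- Any two polycyclic series of a group have the same number of infinite factors. -/
theorem PolycyclicSeries.infiniteFactors_le {G : Type*} [Group G] (s t : PolycyclicSeries G) :
    s.infiniteFactors ≤ t.infiniteFactors := by
  classical
  have h := t.card_chain_le s.length t.length le_rfl s.term s.le_succ
    (fun i _ => by rw [t.term_length]; exact le_top)
  refine le_trans (Finset.card_le_card fun i hi => ?_) h
  rw [Finset.mem_filter] at hi ⊢
  refine ⟨hi.1, ?_⟩
  rw [Subgroup.relIndex, Subgroup.index_eq_zero_iff_infinite]
  exact hi.2

/-- The Hirsch length is the number of infinite factors in any polycyclic series. -/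
theorem PolycyclicSeries.infiniteFactors_eq_hirschLength {G : Type*} [Group G]
    (s : PolycyclicSeries G) : s.infiniteFactors = hirschLength G := by
  have h : IsPolycyclic G := ⟨s⟩
  rw [hirschLength, dif_pos h]
  exact le_antisymm (s.infiniteFactors_le _) (PolycyclicSeries.infiniteFactors_le _ s)

/-! The image `K` of `φ` has finite index in `H`. Granting this, pulling a polycyclic series of `H`
back to `G` keeps every infinite factor of infinite index, and `PolycyclicSeries.card_chain_le`
bounds the number of such steps by the Hirsch length of `G`.

For the index, let `M` be the derived subgroup of `H`, a finitely generated module over the integral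
group ring of the abelianization, with augmentation ideal `I`. Surjectivity on abelianizations gives
`K M = H`, so `W = K ∩ M` is a submodule, and `M = W + I M` because `H` becomes abelian modulo `W +
I M`. Nakayama's lemma yields `r` with `r - 1 ∈ I` and `r M ≤ W`. Residual nilpotence makes `r`
injective on `M`: if `r v = 0` then `v = (1 - r) ^ n v` lies in every term of the lower central
series. An injective endomorphism of a polycyclic group has image of finite index, so `W` has finite
index in `M`, and hence `K` in `H`. -/

/-! ### Polycyclic groups: finite generation, finite index and Hirsch length. -/

/-- A subgroup with finitely generated intersection with `B` and cyclic image modulo `B` is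
finitely generated. -/
theorem fg_of_fg_inf_of_isCyclic {G : Type*} [Group G] {B C L : Subgroup G}
    (hn : (B.subgroupOf C).Normal) (hc : IsCyclic (C ⧸ B.subgroupOf C))
    (hLC : L ≤ C) (hfg : (L ⊓ B).FG) : L.FG := by
  let f : L →* C ⧸ B.subgroupOf C :=
    (QuotientGroup.mk' (B.subgroupOf C)).comp (Subgroup.inclusion hLC)
  have hmem : ∀ x : L, f x = 1 ↔ (x : G) ∈ B := fun x =>
    QuotientGroup.eq_one_iff (N := B.subgroupOf C) (Subgroup.inclusion hLC x)
  obtain ⟨⟨_, c, rfl⟩, hgen⟩ := IsCyclic.exists_generator (α := f.range)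
  -- `c` lifts a generator of the image of `L` modulo `B`, so each `x` in `L` is a power of `c` up
  -- to an element of `L ⊓ B`.
  have hL : L = L ⊓ B ⊔ Subgroup.zpowers (c : G) := by
    refine le_antisymm (fun x hx => ?_)
      (sup_le inf_le_left (Subgroup.zpowers_le.2 c.2))
    obtain ⟨n, hnx⟩ := Subgroup.mem_zpowers_iff.1 (hgen ⟨f ⟨x, hx⟩, ⟨x, hx⟩, rfl⟩)
    have hnx' : f c ^ n = f ⟨x, hx⟩ := congrArg Subtype.val hnx
    have h1 : f (⟨x, hx⟩ * (c ^ n)⁻¹) = 1 := by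
      rw [map_mul, map_inv, map_zpow, hnx', mul_inv_cancel]
    have h2 : x * ((c : G) ^ n)⁻¹ ∈ B := (hmem _).1 h1
    have h3 : x = x * ((c : G) ^ n)⁻¹ * (c : G) ^ n := by group
    rw [h3]
    refine Subgroup.mul_mem_sup ⟨L.mul_mem hx (L.inv_mem (L.zpow_mem c.2 n)), h2⟩ ?_
    exact Subgroup.zpow_mem_zpowers _ _
  rw [hL]
  refine hfg.sup ?_
  rw [Subgroup.zpowers_eq_closure]
  exact ⟨{(c : G)}, by simp⟩

/-- Subgroups of polycyclic groups are finitely generated. -/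
theorem IsPolycyclic.subgroup_fg {G : Type*} [Group G] (h : IsPolycyclic G) (L : Subgroup G) :
    L.FG := by
  obtain ⟨s⟩ := h
  have key : ∀ j ≤ s.length, ∀ L : Subgroup G, L ≤ s.term j → L.FG := by
    intro j
    induction j with
    | zero =>
      intro _ L hL
      rw [s.term_zero, le_bot_iff] at hL
      exact hL ▸ Subgroup.FG.bot
    | succ j ih =>
      intro hj L hL
      exact fg_of_fg_inf_of_isCyclic (s.normal j hj) (s.cyclic j hj) hL
        (ih (Nat.le_of_succ_le hj) _ inf_le_right)
  exact key s.length le_rfl L (s.term_length ▸ le_top)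

/-- An injective endomorphism of a subgroup of a polycyclic group has image of finite index. -/
theorem IsPolycyclic.index_range_ne_zero {G : Type*} [Group G] (h : IsPolycyclic G)
    {M : Subgroup G} (f : M →* M) (hf : Function.Injective f) : f.range.index ≠ 0 := by
  classical
  obtain ⟨s⟩ := h
  intro h0
  -- The iterated images of `f`. By injectivity every step `P (n + 1) ≤ P n` has the same index as
  -- the first, which is `0`, i.e. infinite.
  let P : ℕ → Subgroup M := fun n => (Subgroup.map f)^[n] ⊤
  have hP : ∀ n, P (n + 1) = (P n).map f := fun n => Function.iterate_succ_apply' _ _ _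
  have hle : ∀ n, P (n + 1) ≤ P n := by
    intro n
    induction n with
    | zero => exact le_top
    | succ n ih => exact (hP (n + 1)).trans_le ((Subgroup.map_mono ih).trans (hP n).ge)
  have hidx : ∀ n, (P (n + 1)).relIndex (P n) = 0 := by
    intro n
    induction n with
    | zero =>
      rw [hP]
      change ((⊤ : Subgroup M).map f).relIndex ⊤ = 0
      rw [← MonoidHom.range_eq_map, Subgroup.relIndex_top_right, h0]
    | succ n ih =>
      have hmap := Subgroup.relIndex_map_map_of_injective (P (n + 1)) (P n) hf
      rwa [← hP, ← hP, ih] at hmap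
  -- One step more than the series has factors. The descending chain is reversed, since
  -- `card_chain_le` takes ascending ones.
  set l := s.length + 1 with hl
  have hstep : ∀ i < l, P (l - i) = P (l - (i + 1) + 1) := fun i hi => by
    congr 1; omega
  have hcard := s.card_chain_le l s.length le_rfl (fun i => (P (l - i)).map M.subtype)
    (fun i hi => Subgroup.map_mono ((hstep i hi).trans_le (hle _)))
    (fun i _ => s.term_length ▸ le_top)
  rw [Finset.filter_true_of_mem] at hcard
  · have := hcard.trans (Finset.card_filter_le _ _)
    simp only [Finset.card_range] at this
    omega
  · intro i hi
    rw [Subgroup.relIndex_map_map_of_injective _ _ M.subtype_injective,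
      hstep i (Finset.mem_range.1 hi), hidx]

/-- The Hirsch length does not increase along a homomorphism whose image has finite index. -/
theorem hirschLength_le_of_index_range_ne_zero {G H : Type*} [Group G] [Group H]
    (hG : IsPolycyclic G) (hH : IsPolycyclic H) (φ : G →* H) (hφ : φ.range.index ≠ 0) :
    hirschLength H ≤ hirschLength G := by
  classical
  obtain ⟨s⟩ := hG
  obtain ⟨t⟩ := hH
  rw [← s.infiniteFactors_eq_hirschLength, ← t.infiniteFactors_eq_hirschLength]
  refine le_trans (Finset.card_le_card fun i hi => ?_)
    (s.card_chain_le t.length s.length le_rfl (fun i => (t.term i).comap φ)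
      (fun i hi => Subgroup.comap_mono (t.le_succ i hi)) fun i _ => s.term_length ▸ le_top)
  rw [Finset.mem_filter] at hi ⊢
  refine ⟨hi.1, ?_⟩
  have h0 : (t.term i).relIndex (t.term (i + 1)) = 0 := by
    rw [Subgroup.relIndex, Subgroup.index_eq_zero_iff_infinite]
    exact hi.2
  -- The index to compute is that of `t.term i` in `φ.range ⊓ t.term (i + 1)`. Multiplied by the
  -- finite index of `φ.range` in `t.term (i + 1)` it becomes infinite, so it is infinite itself.
  rw [Subgroup.relIndex_comap, Subgroup.map_comap_eq]
  have h1 : φ.range.relIndex (t.term (i + 1)) ≠ 0 := fun h =>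
    hφ (Subgroup.index_eq_zero_of_relIndex_eq_zero h)
  have h2 := Subgroup.relIndex_inf_mul_relIndex (t.term i) φ.range (t.term (i + 1))
  rw [Subgroup.relIndex_eq_zero_of_le_left inf_le_left h0] at h2
  exact (mul_eq_zero.1 h2).resolve_right h1

/-! ### The derived subgroup as a module over the group ring of the abelianization. -/

section DerivedModule

open scoped IsMulCommutative commutatorElement

variable (H : Type*) [Group H] [IsMulCommutative (commutator H)]

/-- The conjugation action of the abelianization of a metabelian group on its derived subgroup,
written additively. -/
noncomputable def derivedRep : Representation ℤ (Abelianization H) (Additive (commutator H)) :=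
  QuotientGroup.lift (commutator H)
    { toFun := fun h =>
        (MonoidHom.toAdditive
          (MulAut.conjNormal h : MulAut (commutator H)).toMonoidHom).toIntLinearMap
      map_one' := by
        refine LinearMap.ext fun v => Additive.toMul.injective (Subtype.ext ?_)
        simp
      map_mul' := fun a b => by
        refine LinearMap.ext fun v => Additive.toMul.injective (Subtype.ext ?_)
        simp [mul_assoc] }
    (by
      intro x hx
      refine LinearMap.ext fun v => Additive.toMul.injective (Subtype.ext ?_)
      have h := congrArg Subtype.val (mul_comm (⟨x, hx⟩ : commutator H) v.toMul)
      simp only [Subgroup.coe_mul] at h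
      simp [h])

noncomputable instance :
    Module (MonoidAlgebra ℤ (Abelianization H)) (Additive (commutator H)) :=
  Module.compHom _ (MonoidAlgebra.lift ℤ _ _ (derivedRep H)).toRingHom

variable {H}

theorem of_smul_derived (h : H) (v : Additive (commutator H)) :
    ((MonoidAlgebra.of ℤ _ (Abelianization.of h) • v).toMul : H) = h * v.toMul * h⁻¹ := by
  change ((MonoidAlgebra.lift ℤ _ _ (derivedRep H) (MonoidAlgebra.of ℤ _ (Abelianization.of h))
    v).toMul : H) = _
  rw [MonoidAlgebra.lift_of]
  rfl

/-- The dictionary between the augmentation ideal and commutators. -/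
theorem of_sub_one_smul_derived (h : H) (v : Additive (commutator H)) :
    (((MonoidAlgebra.of ℤ _ (Abelianization.of h) - 1) • v).toMul : H) = ⁅h, (v.toMul : H)⁆ := by
  rw [sub_smul, one_smul, toMul_sub, Subgroup.coe_div, of_smul_derived, commutatorElement_def,
    div_eq_mul_inv]

/-- The submodule of the derived subgroup given by a normal subgroup. -/
def derivedSubmodule (P : Subgroup H) [P.Normal] :
    Submodule (MonoidAlgebra ℤ (Abelianization H)) (Additive (commutator H)) where
  carrier := {v | (v.toMul : H) ∈ P}
  add_mem' := fun ha hb => P.mul_mem ha hb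
  zero_mem' := P.one_mem
  smul_mem' := fun r v hv => by
    induction r using MonoidAlgebra.induction_on with
    | of q =>
      obtain ⟨h, rfl⟩ := QuotientGroup.mk_surjective q
      change ((MonoidAlgebra.of ℤ _ (Abelianization.of h) • v).toMul : H) ∈ P
      rw [of_smul_derived]
      exact Subgroup.Normal.conj_mem inferInstance _ hv h
    | add r s hr hs =>
      rw [add_smul]
      exact P.mul_mem hr hs
    | smul n r hr =>
      rw [smul_assoc]
      exact P.zpow_mem hr n

/-- The normal subgroup given by a submodule of the derived subgroup. -/
def derivedSubgroup
    (W : Submodule (MonoidAlgebra ℤ (Abelianization H)) (Additive (commutator H))) :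
    Subgroup H where
  carrier := {x | ∃ v ∈ W, (v.toMul : H) = x}
  mul_mem' := by
    rintro _ _ ⟨v, hv, rfl⟩ ⟨w, hw, rfl⟩
    exact ⟨v + w, W.add_mem hv hw, rfl⟩
  one_mem' := ⟨0, W.zero_mem, rfl⟩
  inv_mem' := by
    rintro _ ⟨v, hv, rfl⟩
    exact ⟨-v, W.neg_mem hv, rfl⟩

instance (W : Submodule (MonoidAlgebra ℤ (Abelianization H)) (Additive (commutator H))) :
    (derivedSubgroup W).Normal where
  conj_mem := by
    rintro _ ⟨v, hv, rfl⟩ h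
    exact ⟨_, W.smul_mem _ hv, of_smul_derived h v⟩

variable (H) in
/-- The augmentation ideal of the integral group ring of the abelianization. -/
noncomputable def augmentationIdeal : Ideal (MonoidAlgebra ℤ (Abelianization H)) :=
  Ideal.span (Set.range fun h : H => MonoidAlgebra.of ℤ _ (Abelianization.of h) - 1)

/-- Each generator `h - 1` of the ideal acts as a commutator with `h`, hence moves one term down the
series. The series is indexed from `0`, with the whole group as its first term. -/
theorem augmentationIdeal_pow_smul_top_le (n : ℕ) :
    (augmentationIdeal H ^ n • ⊤ :
      Submodule (MonoidAlgebra ℤ (Abelianization H)) (Additive (commutator H))) ≤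
      derivedSubmodule ((⊤ : Subgroup H).lowerCentralSeries n) := by
  induction n with
  | zero => exact fun v _ => Subgroup.mem_top (v.toMul : H)
  | succ n ih =>
    rw [pow_succ', Submodule.mul_smul]
    refine Submodule.smul_le.2 fun r hr v hv => ?_
    induction hr using Submodule.span_induction with
    | mem r hr =>
      obtain ⟨h, rfl⟩ := hr
      change (((MonoidAlgebra.of ℤ _ (Abelianization.of h) - 1) • v).toMul : H) ∈
        ⁅(⊤ : Subgroup H).lowerCentralSeries n, (⊤ : Subgroup H)⁆
      rw [of_sub_one_smul_derived, Subgroup.commutator_comm]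
      exact Subgroup.commutator_mem_commutator (Subgroup.mem_top h) (ih hv)
    | zero => rw [zero_smul]; exact Submodule.zero_mem _
    | add r s _ _ hr hs => rw [add_smul]; exact Submodule.add_mem _ hr hs
    | smul a r _ hr => rw [smul_assoc]; exact Submodule.smul_mem _ a hr

/-- A subgroup that generates the group modulo the derived subgroup also generates the derived
subgroup modulo the image of the augmentation ideal. -/
theorem top_le_derivedSubmodule_sup {K : Subgroup H} (hK : K ⊔ commutator H = ⊤)
    (W : Submodule (MonoidAlgebra ℤ (Abelianization H)) (Additive (commutator H)))
    (hKW : ∀ v : Additive (commutator H), (v.toMul : H) ∈ K → v ∈ W) :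
    ⊤ ≤ W ⊔ augmentationIdeal H • ⊤ := by
  set X := W ⊔ augmentationIdeal H • ⊤ with hX
  -- The derived subgroup is central modulo `X`, because `⁅h, m⁆` is `(h - 1) • m`.
  have hc : ∀ (h : H) (m : commutator H),
      Commute (h : H ⧸ derivedSubgroup X) ((m : H) : H ⧸ derivedSubgroup X) := by
    intro h m
    rw [← commutatorElement_eq_one_iff_commute, ← QuotientGroup.mk'_apply, ← QuotientGroup.mk'_apply,
      ← map_commutatorElement]
    refine (QuotientGroup.eq_one_iff _).2 ⟨_, ?_, of_sub_one_smul_derived h (Additive.ofMul m)⟩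
    exact Submodule.mem_sup_right (Submodule.smul_mem_smul (Ideal.subset_span ⟨h, rfl⟩) trivial)
  -- Commutators of elements of `K` lie in `K` and in the derived subgroup, hence in `W`.
  have hk : ∀ a ∈ K, ∀ b ∈ K,
      Commute (a : H ⧸ derivedSubgroup X) (b : H ⧸ derivedSubgroup X) := by
    intro a ha b hb
    rw [← commutatorElement_eq_one_iff_commute, ← QuotientGroup.mk'_apply, ← QuotientGroup.mk'_apply,
      ← map_commutatorElement]
    have hab : ⁅a, b⁆ ∈ commutator H :=
      Subgroup.commutator_mem_commutator (Subgroup.mem_top a) (Subgroup.mem_top b)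
    have habK : ⁅a, b⁆ ∈ K :=
      K.mul_mem (K.mul_mem (K.mul_mem ha hb) (K.inv_mem ha)) (K.inv_mem hb)
    exact (QuotientGroup.eq_one_iff _).2
      ⟨Additive.ofMul ⟨_, hab⟩, Submodule.mem_sup_left (hKW _ habK), rfl⟩
  have hdec : ∀ x : H, ∃ k ∈ K, ∃ m ∈ commutator H, k * m = x := fun x =>
    Subgroup.mem_sup_of_normal_right.1 (hK ▸ Subgroup.mem_top x)
  have hcomm : commutator H ≤ derivedSubgroup X := by
    refine Subgroup.commutator_le.2 fun x _ y _ => ?_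
    rw [← QuotientGroup.eq_one_iff, ← QuotientGroup.mk'_apply, map_commutatorElement,
      commutatorElement_eq_one_iff_commute]
    obtain ⟨a, ha, m, hm, rfl⟩ := hdec x
    obtain ⟨b, hb, n, hn, rfl⟩ := hdec y
    rw [map_mul]
    refine Commute.mul_left ?_ (hc (b * n) ⟨m, hm⟩).symm
    rw [map_mul]
    exact (hk a ha b hb).mul_right (hc a ⟨n, hn⟩)
  intro v _
  obtain ⟨w, hw, hwv⟩ := hcomm v.toMul.2
  have : w = v := Additive.toMul.injective (Subtype.ext hwv)
  exact this ▸ hw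

/-- In a residually nilpotent group, elements congruent to `1` modulo the augmentation ideal act
injectively on the derived subgroup. -/
theorem IsResiduallyNilpotent.smul_injective (hr : IsResiduallyNilpotent H)
    {r : MonoidAlgebra ℤ (Abelianization H)} (hrI : r - 1 ∈ augmentationIdeal H) :
    Function.Injective fun v : Additive (commutator H) => r • v := by
  refine (injective_iff_map_eq_zero (DistribSMul.toAddMonoidHom _ r)).2 fun v hv => ?_
  replace hv : r • v = 0 := hv
  -- An element killed by `r` is fixed by `1 - r`, which lies in the augmentation ideal, so it lies
  -- in the image of every power of that ideal.
  have hv1 : (-(r - 1)) • v = v := by rw [neg_smul, sub_smul, hv, one_smul]; simp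
  have hvn : ∀ n : ℕ, (-(r - 1)) ^ n • v = v := by
    intro n
    induction n with
    | zero => simp
    | succ n ih => rw [pow_succ, mul_smul, hv1, ih]
  have hmem : (v.toMul : H) ∈ ⨅ n : ℕ, (⊤ : Subgroup H).lowerCentralSeries n := by
    refine Subgroup.mem_iInf.2 fun n => ?_
    refine augmentationIdeal_pow_smul_top_le n ?_
    rw [← hvn n]
    exact Submodule.smul_mem_smul (Ideal.pow_mem_pow (Ideal.neg_mem_iff _ |>.2 hrI) n) trivial
  rw [hr, Subgroup.mem_bot] at hmem
  exact Additive.toMul.injective (Subtype.ext hmem)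

/-- In a polycyclic, residually nilpotent, metabelian group, a subgroup that generates the group
modulo the derived subgroup has finite index. -/
theorem index_ne_zero_of_sup_commutator_eq_top (hp : IsPolycyclic H)
    (hr : IsResiduallyNilpotent H) {K : Subgroup H} (hK : K ⊔ commutator H = ⊤) :
    K.index ≠ 0 := by
  have hnormal : (K ⊓ commutator H).Normal := by
    refine ⟨fun x hx h => ?_⟩
    -- In `h = k * m` the factor `m` centralizes the abelian derived subgroup, so only conjugation
    -- by `k ∈ K` matters.
    obtain ⟨k, hk, m, hm, rfl⟩ := Subgroup.mem_sup_of_normal_right.1 (hK ▸ Subgroup.mem_top h)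
    have hmx : m * x = x * m :=
      congrArg Subtype.val (mul_comm (⟨m, hm⟩ : commutator H) ⟨x, hx.2⟩)
    have hconj : k * m * x * (k * m)⁻¹ = k * x * k⁻¹ := by
      rw [mul_assoc k, hmx]; group
    refine ⟨?_, Subgroup.Normal.conj_mem inferInstance _ hx.2 _⟩
    rw [hconj]
    exact K.mul_mem (K.mul_mem hk hx.1) (K.inv_mem hk)
  let W := derivedSubmodule (K ⊓ commutator H)
  have hfg : (⊤ : Submodule (MonoidAlgebra ℤ (Abelianization H))
      (Additive (commutator H))).FG := by
    have : Group.FG (commutator H) :=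
      (Group.fg_iff_subgroup_fg _).2 (hp.subgroup_fg _)
    have : Module.Finite ℤ (Additive (commutator H)) :=
      Module.Finite.iff_addGroup_fg.2 inferInstance
    exact (Module.Finite.of_restrictScalars_finite ℤ
      (MonoidAlgebra ℤ (Abelianization H)) _).fg_top
  -- Nakayama's lemma in determinant form: `r` is `1` modulo the augmentation ideal and maps the
  -- derived subgroup into `W`.
  obtain ⟨r, hrI, hrW⟩ := Submodule.exists_sub_one_mem_and_smul_le_of_fg_of_le_sup hfg le_rfl
    (top_le_derivedSubmodule_sup hK W fun v hv => ⟨hv, v.toMul.2⟩)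
  let f : commutator H →* commutator H :=
    MonoidHom.toAdditive.symm (DistribSMul.toAddMonoidHom (Additive (commutator H)) r)
  have hf : f.range ≤ K.subgroupOf (commutator H) := by
    rintro _ ⟨v, rfl⟩
    exact (hrW (Submodule.smul_mem_pointwise_smul (Additive.ofMul v) r _ trivial)).1
  have hrel : K.relIndex (commutator H) ≠ 0 := fun h0 =>
    hp.index_range_ne_zero f (hr.smul_injective hrI) <| by
      rw [Subgroup.relIndex] at h0
      exact zero_dvd_iff.1 (h0 ▸ Subgroup.index_dvd_of_le hf)
  -- Passing to the abelianization: `K` maps onto it, and meets its kernel, the derived subgroup, in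
  -- finite index.
  refine index_ne_zero_of_map (Abelianization.of (G := H)) K ?_ ?_
  · have : K.map (Abelianization.of (G := H)) = ⊤ := by
      have hbot : (commutator H).map (Abelianization.of (G := H)) = ⊥ :=
        (Subgroup.map_eq_bot_iff _).2 (Abelianization.ker_of H).ge
      have htop := congrArg (Subgroup.map (Abelianization.of (G := H))) hK
      rwa [Subgroup.map_sup, hbot, sup_bot_eq,
        Subgroup.map_top_of_surjective Abelianization.of QuotientGroup.mk_surjective] at htop
    simp [this]
  · rwa [Abelianization.ker_of]

end DerivedModule

theorem theorem3p2 {G : Type*} {H : Type*} [Group G] [Group H]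
    (hGp : IsPolycyclic G) (hGr : IsResiduallyNilpotent G) (hGm : IsMetabelian G)
    (hHp : IsPolycyclic H) (hHr : IsResiduallyNilpotent H) (hHm : IsMetabelian H)
    (φ : G →* H) (hφ : Function.Bijective (Abelianization.map φ)) :
    hirschLength H ≤ hirschLength G := by
  have : IsMulCommutative (commutator H) := by
    rwa [IsMetabelian, derivedSeries_succ, derivedSeries_one,
      Subgroup.commutator_self_eq_bot_iff] at hHm
  refine hirschLength_le_of_index_range_ne_zero hGp hHp φ
    (index_ne_zero_of_sup_commutator_eq_top hHp hHr (eq_top_iff.2 fun h _ => ?_))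
  -- Surjectivity on abelianizations writes `h` as `φ g` times an element of the derived subgroup.
  obtain ⟨q, hq⟩ := hφ.2 (Abelianization.of h)
  obtain ⟨g, rfl⟩ := QuotientGroup.mk_surjective q
  have hgh : (φ g)⁻¹ * h ∈ commutator H := QuotientGroup.eq.1 hq
  rw [← mul_inv_cancel_left (φ g) h]
  exact Subgroup.mul_mem_sup ⟨g, rfl⟩ hgh
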